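/- Let $\mathbb{F}_q$ be a finite field with $q$ elements and let $F\in\mathbb{F}_q[X_0,X_1,X_2]$ be a homogeneous polynomial of degree $m$ that is irreducible over the algebraic closure $\overline{\mathbb{F}}_q$. Let $\mathcal{F}$ be the plane curve $F=0$, and suppose that $\mathcal{F}$ is $\mathbb{F}_q$-Frobenius classical, that is, $F$ does not divide $X_0^q\,\partial F/\partial X_0+X_1^q\,\partial F/\partial X_1+X_2^q\,\partial F/\partial X_2$. Let $P_1,\dots,P_s$ be the distinct inflection points of $\mathcal{F}$ in $\mathbb{P}^2(\mathbb{F}_q)$, that is, the nonsingular $\mathbb{F}_q$-rational points $P$ of $\mathcal{F}$ at which the intersection multiplicity $I(P,\mathcal{F}\cap\mathcal{L})$ of $\mathcal{F}$ with its tangent line $\mathcal{L}$ at $P$ is at least $3$. Let $\mathcal{L}_i$ be the tangent line to $\mathcal{F}$ at $P_i$ and let $m_i=I(P_i,\mathcal{F}\cap\mathcal{L}_i)\ge 3$. Then every $m_i$ is finite, and the number $\#\mathcal{F}(\mathbb{F}_q)$ of points of $\mathbb{P}^2(\mathbb{F}_q)$ on $\mathcal{F}$ satisfies $$\#\mathcal{F}(\mathbb{F}_q)\le\frac{m(m+q-1)-\sum_{i=1}^{s}(m_i-2)}{2}.$$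 If equality holds, then $\mathcal{F}$ is nonsingular, that is, it has no singular point over $\overline{\mathbb{F}}_q$. -/

import Mathlib

open MvPolynomial

open scoped LinearAlgebra.Projectivization

noncomputable section

namespace PlaneCurve

/- Throughout, a plane curve over a field `K` is given by a homogeneous polynomial
`F ∈ K[X₀, X₁, X₂]`, and points are points of `ℙ²(K) = ℙ K (Fin 3 → K)`.  Since `F` is homogeneous,
none of the notions below depends on the representative `P.rep` of the point `P`. -/

variable {K : Type*} [Field K]

/-- The set of `K`-rational points of the curve `F = 0`. -/
def points (F : MvPolynomial (Fin 3) K) : Set (ℙ K (Fin 3 → K)) :=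
  {P | eval P.rep F = 0}

/-- `P` is a singular point of `F = 0`: it lies on the curve and all the partial derivatives
vanish at it. -/
def IsSingularPoint (F : MvPolynomial (Fin 3) K) (P : ℙ K (Fin 3 → K)) : Prop :=
  P ∈ points F ∧ ∀ i, eval P.rep (pderiv i F) = 0

/-- The curve `F = 0` over `K` is nonsingular: it has no singular point over the algebraic closure
of `K`. -/
def IsNonsingular (F : MvPolynomial (Fin 3) K) : Prop :=
  ∀ P : ℙ (AlgebraicClosure K) (Fin 3 → AlgebraicClosure K),
    ¬ IsSingularPoint (map (algebraMap K (AlgebraicClosure K)) F) P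

/-- The tangent line of `F = 0` at a nonsingular point `P`, with equation
`F_{X₀}(P) X₀ + F_{X₁}(P) X₁ + F_{X₂}(P) X₂ = 0`, as a linear subspace of `K³`. -/
def tangentLine (F : MvPolynomial (Fin 3) K) (P : ℙ K (Fin 3 → K)) : Submodule K (Fin 3 → K) :=
  LinearMap.ker (∑ i, eval P.rep (pderiv i F) • (LinearMap.proj i : (Fin 3 → K) →ₗ[K] K))

/-- The one-variable polynomial `F(v + t w)`. -/
def restrict (F : MvPolynomial (Fin 3) K) (v w : Fin 3 → K) : Polynomial K :=
  aeval (fun i => Polynomial.C (v i) + Polynomial.X * Polynomial.C (w i)) F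

/-- The intersection multiplicity `I(P, F ∩ L)` of the curve `F = 0` and a line `L` at a point
`P ∈ L` of the curve: the order of vanishing at `t = 0` of `F(P + t w)`, where `w` is any point
of `L` other than `P`.  The order does not depend on `w`, and it is `⊤` if `w` is a multiple
of `P`; so it is the minimum over all `w ∈ L`.  It is `⊤` if and only if the line is contained
in the curve. -/
def lineMultiplicity (F : MvPolynomial (Fin 3) K) (L : Submodule K (Fin 3 → K))
    (P : ℙ K (Fin 3 → K)) : ℕ∞ :=
  ⨅ w ∈ L, emultiplicity (Polynomial.X : Polynomial K) (restrict F P.rep w)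

/-- The intersection multiplicity of the curve with its tangent line at `P`. -/
def tangentMultiplicity (F : MvPolynomial (Fin 3) K) (P : ℙ K (Fin 3 → K)) : ℕ∞ :=
  lineMultiplicity F (tangentLine F P) P

/-- The `K`-rational inflection points of `F = 0`: the nonsingular points at which the tangent line
meets the curve with multiplicity at least three. -/
def inflectionPoints (F : MvPolynomial (Fin 3) K) : Set (ℙ K (Fin 3 → K)) :=
  {P | P ∈ points F ∧ ¬ IsSingularPoint F P ∧ 3 ≤ tangentMultiplicity F P}

/-- The curve `F = 0` is absolutely irreducible. -/
def IsAbsolutelyIrreducible (F : MvPolynomial (Fin 3) K) : Prop :=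
  Irreducible (map (algebraMap K (AlgebraicClosure K)) F)

/-- `Φ_q(F) = X₀^q F_{X₀} + X₁^q F_{X₁} + X₂^q F_{X₂}`. -/
def frobeniusForm (q : ℕ) (F : MvPolynomial (Fin 3) K) : MvPolynomial (Fin 3) K :=
  ∑ i, X i ^ q * pderiv i F

/-- For `K = 𝔽_q`: the curve `F = 0` is absolutely irreducible and `𝔽_q`-Frobenius classical,
that is, `F` does not divide `Φ_q(F)`. -/
def IsFrobeniusClassical (F : MvPolynomial (Fin 3) K) : Prop :=
  IsAbsolutelyIrreducible F ∧ ¬ F ∣ frobeniusForm (Nat.card K) F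

end PlaneCurve

end

noncomputable section

namespace PlaneCurve

variable {K : Type*} [Field K]

/-! Compare `F` with its Frobenius form, of degree `m + q - 1`. Irreducibility and Frobenius
classicality leave no common component, so Bézout bounds their intersection by `m (m + q - 1)`. At a
rational point, Euler's formula shows that the Frobenius form inherits the contact of `F` with any
rational line. The tangent line thus contributes its multiplicity: at least 2, and `m_i` at an
inflection point. A singular rational point contributes 3. Summing gives twice the number of points,
plus the excesses, plus the number of singular rational points.

In case of equality no rational point is singular. A singular point over the closure is then new,
and the Frobenius form vanishes there too, so it would add at least 1 to a sum already at the bound.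

The form of Bézout needed (`sum_contact_le_mul`) avoids local rings. If both curves vanish to order
`r i` along a line at `v i`, so does the whole ideal `(F, G)`. Forms of large degree realise all
jets of length `r i` independently, while the ideal has codimension only `m n` in such a degree, by
the Koszul relation. -/

/-- Restriction to a parametrised line, as an algebra homomorphism. -/
def restrictHom (v w : Fin 3 → K) : MvPolynomial (Fin 3) K →ₐ[K] Polynomial K :=
  aeval fun i => Polynomial.C (v i) + Polynomial.X * Polynomial.C (w i)

lemma restrict_eq (F : MvPolynomial (Fin 3) K) (v w : Fin 3 → K) :
    restrict F v w = restrictHom v w F := rfl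

lemma restrictHom_X (v w : Fin 3 → K) (i : Fin 3) :
    restrictHom v w (X i) = Polynomial.C (v i) + Polynomial.X * Polynomial.C (w i) := by
  simp [restrictHom]

lemma restrictHom_C (v w : Fin 3 → K) (c : K) :
    restrictHom v w (C c) = Polynomial.C c := by
  simp [restrictHom]

lemma coeff_zero_restrictHom (F : MvPolynomial (Fin 3) K) (v w : Fin 3 → K) :
    (restrictHom v w F).coeff 0 = eval v F := by
  have h : ((Polynomial.aeval (0 : K)).comp (restrictHom v w)) = aeval v := by
    ext i
    simp [restrictHom_X]
  have := DFunLike.congr_fun h F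
  rw [Polynomial.coeff_zero_eq_eval_zero]
  simpa [Polynomial.aeval_def, Polynomial.eval₂_eq_eval_map, aeval_eq_eval] using this

/-! ### Forms with prescribed jets along lines -/

lemma linear_form_properties (a : Fin 3 → K) :
    (∑ i, C (a i) * X i : MvPolynomial (Fin 3) K).IsHomogeneous 1 ∧
    (∀ v, eval v (∑ i, C (a i) * X i) = ∑ i, a i * v i) ∧
    ∀ v w, restrictHom v w (∑ i, C (a i) * X i) =
      Polynomial.C (∑ i, a i * v i) + Polynomial.X * Polynomial.C (∑ i, a i * w i) := by
  refine ⟨IsHomogeneous.sum _ _ _ fun i _ => isHomogeneous_C_mul_X _ _, fun v => by simp,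
    fun v w => ?_⟩
  rw [map_sum, map_sum, map_sum, Finset.mul_sum, ← Finset.sum_add_distrib]
  refine Finset.sum_congr rfl fun i _ => ?_
  rw [map_mul, restrictHom_C, restrictHom_X, Polynomial.C_mul, Polynomial.C_mul]
  ring

lemma exists_linear_form {x y : Fin 3 → K} (h : LinearIndependent K ![x, y]) :
    ∃ l : MvPolynomial (Fin 3) K, l.IsHomogeneous 1 ∧ eval x l = 1 ∧ eval y l = 0 ∧
      ∀ v w, restrictHom v w l =
        Polynomial.C (eval v l) + Polynomial.X * Polynomial.C (eval w l) := by
  have hx : x ∉ Submodule.span K {y} := by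
    intro hx
    obtain ⟨c, hc⟩ := Submodule.mem_span_singleton.1 hx
    have := LinearIndependent.pair_iff.1 h 1 (-c) (by rw [← hc]; module)
    exact one_ne_zero this.1
  obtain ⟨f, hf, hy⟩ := Submodule.exists_le_ker_of_notMem hx
  have hy : f y = 0 := hy (Submodule.mem_span_singleton_self y)
  have hfv : ∀ v, ∑ i, (f x)⁻¹ * f (Pi.single i (1 : K)) * v i = (f x)⁻¹ * f v := by
    intro v
    have : f v = ∑ i, v i * f (Pi.single i (1 : K)) := by
      conv_lhs => rw [pi_eq_sum_univ' v]
      rw [map_sum]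
      refine Finset.sum_congr rfl fun i _ => ?_
      rw [map_smul, smul_eq_mul]
    rw [this, Finset.mul_sum]
    exact Finset.sum_congr rfl fun i _ => by ring
  obtain ⟨h1, h2, h3⟩ := linear_form_properties fun i => (f x)⁻¹ * f (Pi.single i (1 : K))
  refine ⟨_, h1, ?_, ?_, fun v w => ?_⟩
  · rw [h2, hfv, inv_mul_cancel₀ hf]
  · rw [h2, hfv, hy, mul_zero]
  · rw [h2, h2, h3]

/-- Linear forms `a`, `b` dual to `v`, `w` restrict to `1` and `t` on the line `v + t w`, so
monomials in them give every power of `t` up to the degree. -/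
lemma exists_restrictHom_eq_X_pow {v w : Fin 3 → K} (h : LinearIndependent K ![v, w])
    {t N : ℕ} (ht : t ≤ N) :
    ∃ H : MvPolynomial (Fin 3) K, H.IsHomogeneous N ∧ restrictHom v w H = Polynomial.X ^ t := by
  have h' : LinearIndependent K ![w, v] := LinearIndependent.pair_symm_iff.1 h
  obtain ⟨a, ha, h1, h2, h3⟩ := exists_linear_form h
  obtain ⟨b, hb, h4, h5, h6⟩ := exists_linear_form h'
  refine ⟨a ^ (N - t) * b ^ t, ?_, ?_⟩
  · have := (ha.pow (N - t)).mul (hb.pow t)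
    rwa [one_mul, one_mul, Nat.sub_add_cancel ht] at this
  · rw [map_mul, map_pow, map_pow, h3, h6, h1, h2, h4, h5]
    simp

/-- A product of `R`-th powers of linear forms, one through each other `v j` and missing `v i`. The
factor at `j = i` is only required to miss `v i`; it makes the degree independent of `i`. -/
lemma exists_separating {ι : Type*} [Fintype ι] (v w : ι → Fin 3 → K)
    (hvw : ∀ i, LinearIndependent K ![v i, w i])
    (hvv : ∀ i j, i ≠ j → LinearIndependent K ![v i, v j]) (R : ℕ) (i : ι) :
    ∃ G : MvPolynomial (Fin 3) K, G.IsHomogeneous (Fintype.card ι * R) ∧ eval (v i) G ≠ 0 ∧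
      ∀ j, j ≠ i → Polynomial.X ^ R ∣ restrictHom (v j) (w j) G := by
  have key : ∀ j, ∃ l : MvPolynomial (Fin 3) K, l.IsHomogeneous 1 ∧ eval (v i) l = 1 ∧
      (j ≠ i → Polynomial.X ∣ restrictHom (v j) (w j) l) := by
    intro j
    by_cases hj : j = i
    · obtain ⟨l, hl, hl1, -⟩ := exists_linear_form (hvw i)
      exact ⟨l, hl, hl1, fun h => absurd hj h⟩
    · obtain ⟨l, hl, hl1, hl2, hl3⟩ := exists_linear_form (hvv i j (Ne.symm hj))
      refine ⟨l, hl, hl1, fun _ => ?_⟩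
      rw [hl3, hl2]
      simp
  choose l hl hl1 hl2 using key
  refine ⟨∏ j, l j ^ R, ?_, ?_, fun j hj => ?_⟩
  · have := IsHomogeneous.prod Finset.univ (fun j => l j ^ R) (fun _ => R)
      (fun j _ => by simpa using (hl j).pow R)
    simpa using this
  · simp [map_prod, hl1]
  · rw [map_prod]
    refine dvd_trans ?_ (Finset.dvd_prod_of_mem _ (Finset.mem_univ j))
    rw [map_pow]
    exact pow_dvd_pow_of_dvd (hl2 j hj) R

/-- Forms of a fixed degree with prescribed jets along pairwise disjoint tangent directions. -/
lemma exists_jet_independent {ι : Type*} [Fintype ι] (v w : ι → Fin 3 → K)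
    (hvw : ∀ i, LinearIndependent K ![v i, w i])
    (hvv : ∀ i j, i ≠ j → LinearIndependent K ![v i, v j]) (r : ι → ℕ) :
    ∃ e₀ : ℕ, ∀ d, e₀ ≤ d → ∃ E : (Σ i, Fin (r i)) → MvPolynomial (Fin 3) K,
      (∀ x, (E x).IsHomogeneous d) ∧
      ∀ c : (Σ i, Fin (r i)) → K,
        (∀ i, Polynomial.X ^ r i ∣ restrictHom (v i) (w i) (∑ x, c x • E x)) → c = 0 := by
  classical
  set R := ∑ i, r i with hR
  have hr : ∀ i, r i ≤ R := fun i => Finset.single_le_sum (fun _ _ => Nat.zero_le _) (Finset.mem_univ i)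
  refine ⟨Fintype.card ι * R + R, fun d hd => ?_⟩
  choose G hG hG1 hG2 using exists_separating v w hvw hvv R
  have key : ∀ x : (Σ i, Fin (r i)), ∃ H : MvPolynomial (Fin 3) K,
      H.IsHomogeneous (d - Fintype.card ι * R) ∧
        restrictHom (v x.1) (w x.1) H = Polynomial.X ^ (x.2 : ℕ) := fun x =>
    exists_restrictHom_eq_X_pow (hvw x.1) (by have := hr x.1; have := x.2.2; omega)
  choose H hH hH1 using key
  -- `G` kills the jets at all other points; `H` supplies the chosen power of `t` at its own.
  refine ⟨fun x => G x.1 * H x, fun x => ?_, fun c hc => ?_⟩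
  · have := (hG x.1).mul (hH x)
    rwa [Nat.add_sub_cancel' (by omega)] at this
  · ext ⟨i, t⟩
    have h1 := hc i
    rw [Fintype.sum_sigma, map_sum, ← Finset.add_sum_erase _ _ (Finset.mem_univ i)] at h1
    have h2 : Polynomial.X ^ r i ∣ ∑ j ∈ Finset.univ.erase i, restrictHom (v i) (w i)
        (∑ t : Fin (r j), c ⟨j, t⟩ • (G j * H ⟨j, t⟩)) := by
      refine Finset.dvd_sum fun j hj => ?_
      rw [map_sum]
      refine Finset.dvd_sum fun t _ => ?_
      rw [map_smul, map_mul]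
      exact dvd_smul_of_dvd _ (((pow_dvd_pow _ (hr i)).trans
        (hG2 j i (Finset.ne_of_mem_erase hj).symm)).mul_right _)
    have h3 := (dvd_add_left h2).1 h1
    have h4 : restrictHom (v i) (w i) (∑ t : Fin (r i), c ⟨i, t⟩ • (G i * H ⟨i, t⟩)) =
        restrictHom (v i) (w i) (G i) *
          ∑ t : Fin (r i), Polynomial.C (c ⟨i, t⟩) * Polynomial.X ^ (t : ℕ) := by
      rw [map_sum, Finset.mul_sum]
      refine Finset.sum_congr rfl fun t _ => ?_
      rw [map_smul, map_mul, hH1 ⟨i, t⟩, Polynomial.smul_eq_C_mul]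
      ring
    rw [h4] at h3
    -- `G` is a unit modulo powers of `X`, so it cancels, leaving a polynomial of degree below `r i`
    -- divisible by `X ^ r i`.
    have h5 : ¬ Polynomial.X ∣ restrictHom (v i) (w i) (G i) := by
      rw [Polynomial.X_dvd_iff, coeff_zero_restrictHom]
      exact hG1 i
    have h6 := Polynomial.prime_X.pow_dvd_of_dvd_mul_left _ h5 h3
    have h7 := Polynomial.X_pow_dvd_iff.1 h6 t t.2
    rw [Polynomial.finsetSum_coeff, Finset.sum_eq_single t] at h7
    · simpa using h7
    · intro s _ hs
      rw [Polynomial.coeff_C_mul_X_pow, if_neg]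
      exact fun h => hs (Fin.ext h.symm)
    · simp

/-! ### Dimension counts and Bézout's bound -/

instance finite_homogeneousSubmodule (d : ℕ) :
    Module.Finite K (homogeneousSubmodule (Fin 3) K d) :=
  Module.Finite.of_fg (homogeneousSubmodule_fg (Fin 3) K d)

lemma finrank_homogeneousSubmodule (d : ℕ) :
    Module.finrank K (homogeneousSubmodule (Fin 3) K d) = (d + 2).choose 2 := by
  rw [homogeneousSubmodule_eq_finsupp_supported]
  have hs : {s : Fin 3 →₀ ℕ | s.degree = d} = ↑(Finset.univ.finsuppAntidiag d : Finset (Fin 3 →₀ ℕ)) := by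
    ext s
    simp [Finsupp.degree_eq_sum]
  have := Module.finrank_eq_nat_card_basis (basisRestrictSupport K {s : Fin 3 →₀ ℕ | s.degree = d})
  rw [restrictSupport] at this
  rw [this, hs, Nat.card_coe_set_eq, Set.ncard_coe_finset,
    Finset.card_finsuppAntidiag_nat_eq_choose, Finset.card_univ, Fintype.card_fin,
    show 3 + d - 1 = d + 2 by omega, Nat.choose_symm_add]

/-- A quotient of homogeneous polynomials may be taken homogeneous. -/
lemma exists_homogeneous_of_dvd {m n : ℕ} {F B : MvPolynomial (Fin 3) K} (hF : F.IsHomogeneous m)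
    (hB : B.IsHomogeneous (m + n)) (h : F ∣ B) :
    ∃ A : MvPolynomial (Fin 3) K, A.IsHomogeneous n ∧ B = F * A := by
  obtain ⟨Q, hQ⟩ := h
  refine ⟨homogeneousComponent n Q, homogeneousComponent_isHomogeneous n Q, ?_⟩
  let _ := gradedAlgebra (σ := Fin 3) (R := K)
  have h1 := DirectSum.coe_decompose_mul_add_of_left_mem (homogeneousSubmodule (Fin 3) K)
    (i := m) (j := n) (b := Q) hF
  rw [← hQ] at h1
  have h2 := homogeneousComponent_of_mem (n := m + n) (m := m + n) hB
  rw [if_pos rfl] at h2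
  rw [← h2]
  exact ((decomposition.decompose'_apply B (m + n)).symm.trans h1).trans
    (congrArg (F * ·) (decomposition.decompose'_apply Q n))

/-- The alternating sum of dimensions in the Koszul complex of forms of degrees `m` and `n`, taken
in degree `m + n + e`. -/
lemma choose_identity (m n e : ℕ) :
    (m + n + e + 2).choose 2 + (e + 2).choose 2 =
      (n + e + 2).choose 2 + (m + e + 2).choose 2 + m * n := by
  have h : ∀ a : ℕ, (((a + 2).choose 2 : ℕ) : ℚ) = (a + 2) * (a + 1) / 2 := by
    intro a
    rw [Nat.cast_choose_two]
    push_cast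
    ring
  have : (((m + n + e + 2).choose 2 + (e + 2).choose 2 : ℕ) : ℚ) =
      (((n + e + 2).choose 2 + (m + e + 2).choose 2 + m * n : ℕ) : ℚ) := by
    push_cast
    simp only [h]
    push_cast
    ring
  exact_mod_cast this

/-- A system of forms of degree `m + n + e` which is linearly independent modulo the forms
`A F + B G` has at most `m n` members. -/
lemma card_le_of_independent {m n e : ℕ} {F G : MvPolynomial (Fin 3) K} (hF : F.IsHomogeneous m)
    (hG : G.IsHomogeneous n) (hp : Prime F) (hFG : ¬ F ∣ G) {κ : Type*} [Fintype κ]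
    (E : κ → MvPolynomial (Fin 3) K) (hE : ∀ x, (E x).IsHomogeneous (m + n + e))
    (hind : ∀ (c : κ → K) (A B : MvPolynomial (Fin 3) K),
      ∑ x, c x • E x + (A * F + B * G) = 0 → c = 0) :
    Fintype.card κ ≤ m * n := by
  classical
  let V := fun d => homogeneousSubmodule (Fin 3) K d
  let Θ : ((κ → K) × V (n + e) × V (m + e)) →ₗ[K] MvPolynomial (Fin 3) K :=
    LinearMap.coprod (Fintype.linearCombination K E)
      (LinearMap.coprod ((LinearMap.mulRight K F).comp (V (n + e)).subtype)
        ((LinearMap.mulRight K G).comp (V (m + e)).subtype))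
  have hΘ : ∀ c A B, Θ (c, A, B) = ∑ x, c x • E x + ((A : MvPolynomial (Fin 3) K) * F + B * G) := by
    intro c A B
    simp [Θ, Fintype.linearCombination_apply]
  have hrange : LinearMap.range Θ ≤ V (m + n + e) := by
    rintro _ ⟨⟨c, A, B⟩, rfl⟩
    rw [hΘ]
    refine Submodule.add_mem _ (Submodule.sum_mem _ fun x _ => Submodule.smul_mem _ _ (hE x))
      (Submodule.add_mem _ ?_ ?_)
    · have := IsHomogeneous.mul A.2 hF
      rwa [show n + e + m = m + n + e by ring] at this
    · have := IsHomogeneous.mul B.2 hG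
      rwa [show m + e + n = m + n + e by ring] at this
  let f1 : V e →ₗ[K] V (n + e) := (LinearMap.mulLeft K (-G)).restrict fun x hx =>
    IsHomogeneous.mul hG.neg hx
  let f2 : V e →ₗ[K] V (m + e) := (LinearMap.mulLeft K F).restrict fun x hx =>
    IsHomogeneous.mul hF hx
  let ψ : V e →ₗ[K] ((κ → K) × V (n + e) × V (m + e)) := LinearMap.prod 0 (LinearMap.prod f1 f2)
  -- Independence removes `c`; then `F` divides `B G`, hence `B`, and only the Koszul syzygies `(-G
  -- Q, F Q)` remain.
  have hker : LinearMap.ker Θ ≤ LinearMap.range ψ := by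
    rintro ⟨c, A, B⟩ h
    rw [LinearMap.mem_ker, hΘ] at h
    have hc := hind c A B h
    have h' : (A : MvPolynomial (Fin 3) K) * F + B * G = 0 := by simpa [hc] using h
    have hd : F ∣ (B : MvPolynomial (Fin 3) K) := by
      have : F ∣ (B : MvPolynomial (Fin 3) K) * G := ⟨-A, by linear_combination h'⟩
      exact (hp.dvd_or_dvd this).resolve_right hFG
    obtain ⟨Q, hQ, hBQ⟩ := exists_homogeneous_of_dvd hF B.2 hd
    refine ⟨⟨Q, hQ⟩, ?_⟩
    have hA : (A : MvPolynomial (Fin 3) K) = -G * Q := by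
      apply mul_right_cancel₀ hp.ne_zero
      rw [hBQ] at h'
      linear_combination h'
    refine Prod.ext hc.symm (Prod.ext (Subtype.ext ?_) (Subtype.ext ?_))
    · exact hA.symm
    · exact hBQ.symm
  have h1 := LinearMap.finrank_range_add_finrank_ker Θ
  have h2 := Submodule.finrank_mono hrange
  have h3 := Submodule.finrank_mono hker
  have h4 := LinearMap.finrank_range_le ψ
  simp only [Module.finrank_prod, Module.finrank_fintype_fun_eq_card, V,
    finrank_homogeneousSubmodule] at h1 h2 h3 h4
  have := choose_identity m n e
  omega

/-- Bézout's bound: two plane curves without common component, of degrees `m` and `n`, which both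
have contact of order `r i` with a line at the point `v i`. -/
theorem sum_contact_le_mul {ι : Type*} [Fintype ι] {m n : ℕ} {F G : MvPolynomial (Fin 3) K}
    (hF : F.IsHomogeneous m) (hG : G.IsHomogeneous n) (hp : Prime F) (hFG : ¬ F ∣ G)
    (v w : ι → Fin 3 → K) (hvw : ∀ i, LinearIndependent K ![v i, w i])
    (hvv : ∀ i j, i ≠ j → LinearIndependent K ![v i, v j]) (r : ι → ℕ)
    (hFr : ∀ i, Polynomial.X ^ r i ∣ restrictHom (v i) (w i) F)
    (hGr : ∀ i, Polynomial.X ^ r i ∣ restrictHom (v i) (w i) G) :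
    ∑ i, r i ≤ m * n := by
  obtain ⟨e, he⟩ := exists_jet_independent v w hvw hvv r
  obtain ⟨E, hE, hc⟩ := he (m + n + e) (Nat.le_add_left _ _)
  have := card_le_of_independent hF hG hp hFG E hE fun c A B h => hc c fun i => by
    rw [eq_neg_of_add_eq_zero_left h, map_neg, map_add, map_mul, map_mul, dvd_neg]
    exact dvd_add ((hFr i).mul_left _) ((hGr i).mul_left _)
  simpa [Fintype.card_sigma] using this

/-! ### The Frobenius form along a line -/

lemma derivative_restrictHom (v w : Fin 3 → K) (F : MvPolynomial (Fin 3) K) :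
    Polynomial.derivative (restrictHom v w F) =
      ∑ i, Polynomial.C (w i) * restrictHom v w (pderiv i F) := by
  induction F using MvPolynomial.induction_on with
  | C a => simp
  | add p q hp hq => simp only [map_add, hp, hq, mul_add, Finset.sum_add_distrib]
  | mul_X p j hp =>
    have h : ∀ i, Polynomial.C (w i) * restrictHom v w (pderiv i (p * X j)) =
        restrictHom v w (X j) * (Polynomial.C (w i) * restrictHom v w (pderiv i p)) +
          restrictHom v w p * (if i = j then Polynomial.C (w i) else 0) := by
      intro i
      rw [pderiv_mul, pderiv_X, map_add, map_mul, map_mul]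
      by_cases hij : i = j
      · subst hij
        rw [Pi.single_eq_same, if_pos rfl, map_one]
        ring
      · rw [Pi.single_eq_of_ne (Ne.symm hij), if_neg hij, map_zero]
        ring
    rw [Finset.sum_congr rfl fun i _ => h i, Finset.sum_add_distrib, ← Finset.mul_sum,
      ← Finset.mul_sum, ← hp, map_mul, Polynomial.derivative_mul, Finset.sum_ite_eq' Finset.univ j,
      if_pos (Finset.mem_univ j), restrictHom_X]
    simp
    ring

/-- Since `v` is fixed by Frobenius, `(v + t w)^q = (v + t w) - t w + t^q w^q` coordinatewise. The
three terms give Euler's formula, the derivative along the line, and a remainder divisible by `t^q`.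
-/
lemma restrictHom_frobeniusForm {q m : ℕ} {F : MvPolynomial (Fin 3) K} (hF : F.IsHomogeneous m)
    (hq : ∀ a b : Polynomial K, (a + b) ^ q = a ^ q + b ^ q) {v : Fin 3 → K}
    (hv : ∀ i, v i ^ q = v i) (w : Fin 3 → K) :
    restrictHom v w (frobeniusForm q F) = m • restrictHom v w F -
      Polynomial.X * Polynomial.derivative (restrictHom v w F) +
      Polynomial.X ^ q * ∑ i, Polynomial.C (w i ^ q) * restrictHom v w (pderiv i F) := by
  rw [← map_nsmul, ← hF.sum_X_mul_pderiv, derivative_restrictHom, frobeniusForm, map_sum, map_sum,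
    Finset.mul_sum, Finset.mul_sum, ← Finset.sum_sub_distrib, ← Finset.sum_add_distrib]
  refine Finset.sum_congr rfl fun i _ => ?_
  rw [map_mul, map_mul, map_pow, restrictHom_X, hq, mul_pow, ← Polynomial.C_pow,
    ← Polynomial.C_pow, hv]
  ring

lemma X_pow_dvd_X_mul_derivative {r : ℕ} {p : Polynomial K} (h : Polynomial.X ^ r ∣ p) :
    Polynomial.X ^ r ∣ Polynomial.X * Polynomial.derivative p := by
  rcases r with _ | r
  · simp
  · have h' := Polynomial.pow_sub_one_dvd_derivative_of_pow_dvd h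
    rw [Nat.add_sub_cancel] at h'
    rw [pow_succ']
    exact mul_dvd_mul_left _ h'

lemma X_pow_dvd_restrictHom_frobeniusForm {q m r : ℕ} {F : MvPolynomial (Fin 3) K}
    (hF : F.IsHomogeneous m) (hq : ∀ a b : Polynomial K, (a + b) ^ q = a ^ q + b ^ q)
    {v : Fin 3 → K} (hv : ∀ i, v i ^ q = v i) {w : Fin 3 → K}
    (h : Polynomial.X ^ r ∣ restrictHom v w F)
    (h' : Polynomial.X ^ r ∣
      Polynomial.X ^ q * ∑ i, Polynomial.C (w i ^ q) * restrictHom v w (pderiv i F)) :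
    Polynomial.X ^ r ∣ restrictHom v w (frobeniusForm q F) := by
  rw [restrictHom_frobeniusForm hF hq hv]
  exact dvd_add (dvd_sub (dvd_smul_of_dvd _ h) (X_pow_dvd_X_mul_derivative h)) h'

/-- At a rational point, contact of the curve with a rational line is inherited by the Frobenius
form. -/
lemma X_pow_dvd_frobeniusForm_of_rational {q m r : ℕ} (hq0 : q ≠ 0) {F : MvPolynomial (Fin 3) K}
    (hF : F.IsHomogeneous m) (hq : ∀ a b : Polynomial K, (a + b) ^ q = a ^ q + b ^ q)
    {v w : Fin 3 → K} (hv : ∀ i, v i ^ q = v i) (hw : ∀ i, w i ^ q = w i)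
    (h : Polynomial.X ^ r ∣ restrictHom v w F) :
    Polynomial.X ^ r ∣ restrictHom v w (frobeniusForm q F) := by
  refine X_pow_dvd_restrictHom_frobeniusForm hF hq hv h ?_
  -- For rational `w` the remainder is `t^q` times the derivative of the restriction, and a single
  -- factor `t` restores the order lost by differentiating.
  simp only [hw]
  rw [← derivative_restrictHom]
  exact (X_pow_dvd_X_mul_derivative h).trans (mul_dvd_mul_right (dvd_pow_self _ hq0) _)

/-- The quadratic term of a polynomial along a pencil of lines. -/
lemma exists_polarisation (v a b : Fin 3 → K) (F : MvPolynomial (Fin 3) K) :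
    ∃ B : K, ∀ x : K,
      (restrictHom v (b + x • a) F).coeff 1 =
        (restrictHom v b F).coeff 1 + x * (restrictHom v a F).coeff 1 ∧
      (restrictHom v (b + x • a) F).coeff 2 =
        (restrictHom v b F).coeff 2 + x * B + x ^ 2 * (restrictHom v a F).coeff 2 := by
  induction F using MvPolynomial.induction_on with
  | C c => exact ⟨0, fun x => by simp⟩
  | add p q hp hq =>
    obtain ⟨B, hB⟩ := hp
    obtain ⟨B', hB'⟩ := hq
    refine ⟨B + B', fun x => ?_⟩
    simp only [map_add, Polynomial.coeff_add, hB x, hB' x]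
    constructor <;> ring
  | mul_X p j hp =>
    obtain ⟨B, hB⟩ := hp
    have h1 : ∀ w, (restrictHom v w (p * X j)).coeff 1 =
        (restrictHom v w p).coeff 1 * v j + eval v p * w j := by
      intro w
      rw [map_mul, restrictHom_X, mul_add, ← mul_assoc, Polynomial.coeff_add,
        Polynomial.coeff_mul_C, Polynomial.coeff_mul_C, Polynomial.coeff_mul_X,
        coeff_zero_restrictHom]
    have h2 : ∀ w, (restrictHom v w (p * X j)).coeff 2 =
        (restrictHom v w p).coeff 2 * v j + (restrictHom v w p).coeff 1 * w j := by
      intro w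
      rw [map_mul, restrictHom_X, mul_add, ← mul_assoc, Polynomial.coeff_add,
        Polynomial.coeff_mul_C, Polynomial.coeff_mul_C, Polynomial.coeff_mul_X]
    refine ⟨B * v j + (restrictHom v b p).coeff 1 * a j + (restrictHom v a p).coeff 1 * b j,
      fun x => ?_⟩
    simp only [h1, h2, hB x, Pi.add_apply, Pi.smul_apply, smul_eq_mul]
    constructor <;> ring

/-- On a pencil of directions `b + x a` the second coefficient is a quadratic polynomial in `x`,
which has a root. Choosing `b` outside the span of `v` and `a` keeps the direction independent of
`v`. -/
lemma exists_coeff_two_eq_zero [IsAlgClosed K] {v : Fin 3 → K} (hv : v ≠ 0)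
    (F : MvPolynomial (Fin 3) K) :
    ∃ w, LinearIndependent K ![v, w] ∧ (restrictHom v w F).coeff 2 = 0 := by
  classical
  obtain ⟨a, ha⟩ := exists_linearIndependent_pair_of_one_lt_finrank (R := K) (by simp) hv
  by_cases ha0 : (restrictHom v a F).coeff 2 = 0
  · exact ⟨a, ha, ha0⟩
  obtain ⟨b, hb⟩ : ∃ b, b ∉ Submodule.span K {v, a} := by
    by_contra! h
    have h1 : Submodule.span K {v, a} = ⊤ := eq_top_iff.2 fun x _ => h x
    have h2 := finrank_span_finset_le_card (R := K) ({v, a} : Finset (Fin 3 → K))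
    have h3 := Finset.card_le_two (a := v) (b := a)
    rw [Finset.coe_pair, Set.finrank, h1, finrank_top, Module.finrank_fin_fun] at h2
    omega
  obtain ⟨B, hB⟩ := exists_polarisation v a b F
  obtain ⟨x, hx⟩ := IsAlgClosed.exists_root (Polynomial.C ((restrictHom v a F).coeff 2) *
    Polynomial.X ^ 2 + Polynomial.C B * Polynomial.X + Polynomial.C ((restrictHom v b F).coeff 2))
    (by rw [Polynomial.degree_quadratic ha0]; decide)
  refine ⟨b + x • a, (LinearIndependent.pair_iff' hv).2 fun c hc => hb ?_, ?_⟩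
  · rw [Submodule.mem_span_pair]
    exact ⟨c, -x, by rw [hc]; module⟩
  · rw [(hB x).2]
    simp only [Polynomial.IsRoot.def, Polynomial.eval_add, Polynomial.eval_mul, Polynomial.eval_C,
      Polynomial.eval_pow, Polynomial.eval_X] at hx
    linear_combination hx

/-- At a rational singular point, the curve and its Frobenius form have contact of order three with
a common line. -/
lemma exists_contact_three_of_singular [IsAlgClosed K] {q m : ℕ} (hq2 : 2 ≤ q)
    {F : MvPolynomial (Fin 3) K} (hF : F.IsHomogeneous m)
    (hq : ∀ a b : Polynomial K, (a + b) ^ q = a ^ q + b ^ q)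
    {v : Fin 3 → K} (hv0 : v ≠ 0) (hv : ∀ i, v i ^ q = v i) (h0 : eval v F = 0)
    (h1 : ∀ i, eval v (pderiv i F) = 0) :
    ∃ w, LinearIndependent K ![v, w] ∧ Polynomial.X ^ 3 ∣ restrictHom v w F ∧
      Polynomial.X ^ 3 ∣ restrictHom v w (frobeniusForm q F) := by
  obtain ⟨w, hw, hw2⟩ := exists_coeff_two_eq_zero hv0 F
  have hd : ∀ i, Polynomial.X ∣ restrictHom v w (pderiv i F) := fun i => by
    rw [Polynomial.X_dvd_iff, coeff_zero_restrictHom, h1]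
  have h3 : Polynomial.X ^ 3 ∣ restrictHom v w F := by
    rw [Polynomial.X_pow_dvd_iff]
    intro d hd3
    interval_cases d
    · rw [coeff_zero_restrictHom, h0]
    · have : (Polynomial.derivative (restrictHom v w F)).coeff 0 = 0 := by
        rw [derivative_restrictHom, ← Polynomial.X_dvd_iff]
        exact Finset.dvd_sum fun i _ => (hd i).mul_left _
      simpa [Polynomial.coeff_derivative] using this
    · exact hw2
  refine ⟨w, hw, h3, X_pow_dvd_restrictHom_frobeniusForm hF hq hv h3 ?_⟩
  -- `q ≥ 2` yields two factors `X`; the partials, vanishing at `v`, yield the third. The direction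
  -- `w` need not be rational.
  rw [pow_succ]
  exact mul_dvd_mul (pow_dvd_pow _ hq2) (Finset.dvd_sum fun i _ => (hd i).mul_left _)

/-! ### Field extension and tangent lines -/

lemma restrictHom_map {L : Type*} [Field L] [Algebra K L] (v w : Fin 3 → K)
    (F : MvPolynomial (Fin 3) K) :
    restrictHom (algebraMap K L ∘ v) (algebraMap K L ∘ w) (map (algebraMap K L) F) =
      (restrictHom v w F).map (algebraMap K L) := by
  induction F using MvPolynomial.induction_on with
  | C a => rw [map_C, restrictHom_C, restrictHom_C, Polynomial.map_C]
  | add p q hp hq => rw [map_add, map_add, map_add, Polynomial.map_add, hp, hq]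
  | mul_X p j hp =>
    rw [map_mul, map_mul, map_mul, map_X, Polynomial.map_mul, hp, restrictHom_X, restrictHom_X]
    simp

lemma map_frobeniusForm {L : Type*} [Field L] [Algebra K L] (q : ℕ) (F : MvPolynomial (Fin 3) K) :
    map (algebraMap K L) (frobeniusForm q F) = frobeniusForm q (map (algebraMap K L) F) := by
  simp [frobeniusForm, pderiv_map]

/-- Divisibility of polynomials descends along a field extension. -/
lemma dvd_of_map_dvd_map {L : Type*} [Field L] [Algebra K L] {F G : MvPolynomial (Fin 3) K}
    (h : map (algebraMap K L) F ∣ map (algebraMap K L) G) : F ∣ G := by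
  obtain ⟨Q, hQ⟩ := h
  -- A `K`-linear retraction `L → K`, applied to the coefficients of the cofactor, gives a cofactor
  -- over `K`.
  obtain ⟨s, hs⟩ := (Algebra.linearMap K L).exists_leftInverse_of_injective
    (LinearMap.ker_eq_bot.2 (algebraMap K L).injective)
  have hs' : ∀ a : K, s (algebraMap K L a) = a := fun a => LinearMap.congr_fun hs a
  have hcoeff : ∀ d, coeff d (∑ e ∈ Q.support, monomial e (s (coeff e Q))) = s (coeff d Q) := by
    intro d
    rw [coeff_sum]
    simp only [coeff_monomial, Finset.sum_ite_eq', mem_support_iff]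
    by_cases hd : coeff d Q = 0 <;> simp [hd]
  refine ⟨∑ e ∈ Q.support, monomial e (s (coeff e Q)), ?_⟩
  ext d
  have := congrArg (fun p => s (coeff d p)) hQ
  simp only [coeff_map, hs', coeff_mul, map_sum] at this
  rw [this, coeff_mul]
  refine Finset.sum_congr rfl fun x _ => ?_
  rw [hcoeff, ← Algebra.smul_def, map_smul, smul_eq_mul]

lemma isHomogeneous_frobeniusForm {m : ℕ} {F : MvPolynomial (Fin 3) K} (hF : F.IsHomogeneous m)
    (q : ℕ) : (frobeniusForm q F).IsHomogeneous (q + (m - 1)) :=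
  IsHomogeneous.sum _ _ _ fun i _ => (isHomogeneous_X_pow i q).mul hF.pderiv

lemma mem_tangentLine {F : MvPolynomial (Fin 3) K} {P : ℙ K (Fin 3 → K)} {w : Fin 3 → K} :
    w ∈ tangentLine F P ↔ ∑ i, eval P.rep (pderiv i F) * w i = 0 := by
  simp [tangentLine]

/-- The kernel of one linear functional on a 3-dimensional space has dimension at least 2, so it is
not contained in the span of `P`. -/
lemma exists_mem_tangentLine (F : MvPolynomial (Fin 3) K) (P : ℙ K (Fin 3 → K)) :
    ∃ w ∈ tangentLine F P, LinearIndependent K ![P.rep, w] := by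
  by_contra! h
  have h1 : tangentLine F P ≤ Submodule.span K {P.rep} := by
    intro w hw
    have h2 := h w hw
    rw [LinearIndependent.pair_iff' P.rep_nonzero] at h2
    push Not at h2
    exact Submodule.mem_span_singleton.2 h2
  have h2 := (Submodule.finrank_mono h1).trans (finrank_span_singleton P.rep_nonzero).le
  rw [tangentLine] at h2
  generalize (∑ i, eval P.rep (pderiv i F) • (LinearMap.proj i : (Fin 3 → K) →ₗ[K] K)) = f at h2
  have h3 := LinearMap.finrank_range_add_finrank_ker f
  have h4 := Submodule.finrank_le (LinearMap.range f)
  rw [Module.finrank_self] at h4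
  rw [Module.finrank_fin_fun] at h3
  omega

lemma exists_contact_of_le_tangentMultiplicity {F : MvPolynomial (Fin 3) K} {P : ℙ K (Fin 3 → K)}
    {r : ℕ} (hr : (r : ℕ∞) ≤ tangentMultiplicity F P) :
    ∃ w, LinearIndependent K ![P.rep, w] ∧ Polynomial.X ^ r ∣ restrictHom P.rep w F := by
  obtain ⟨w, hw, hw'⟩ := exists_mem_tangentLine F P
  refine ⟨w, hw', pow_dvd_of_le_emultiplicity (hr.trans ?_)⟩
  exact iInf₂_le w hw

lemma two_le_tangentMultiplicity {F : MvPolynomial (Fin 3) K} {P : ℙ K (Fin 3 → K)}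
    (hP : P ∈ points F) : 2 ≤ tangentMultiplicity F P := by
  refine le_iInf₂ fun w hw => ?_
  rw [mem_tangentLine] at hw
  refine le_emultiplicity_of_pow_dvd (k := 2) ?_
  rw [restrict_eq, Polynomial.X_pow_dvd_iff]
  intro d hd
  interval_cases d
  · rw [coeff_zero_restrictHom]
    exact hP
  · have : (Polynomial.derivative (restrictHom P.rep w F)).coeff 0 = 0 := by
      rw [derivative_restrictHom, Polynomial.finsetSum_coeff]
      simp only [Polynomial.coeff_C_mul, coeff_zero_restrictHom]
      rw [← hw]
      exact Finset.sum_congr rfl fun i _ => mul_comm _ _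
    simpa [Polynomial.coeff_derivative] using this

lemma eval_smul_of_isHomogeneous {m : ℕ} {F : MvPolynomial (Fin 3) K} (hF : F.IsHomogeneous m)
    (c : K) (v : Fin 3 → K) : eval (c • v) F = c ^ m * eval v F := by
  rw [eval_eq, eval_eq, Finset.mul_sum]
  refine Finset.sum_congr rfl fun d hd => ?_
  have hdeg : ∑ i ∈ d.support, d i = m := (hF.degree_eq_sum_deg_support hd).symm
  simp only [Pi.smul_apply, smul_eq_mul, mul_pow, Finset.prod_mul_distrib]
  rw [Finset.prod_pow_eq_pow_sum, hdeg]
  ring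

/-! ### Counting contacts over a finite field -/

section FiniteField

variable {k : Type*} [Field k]

lemma add_pow_natCard_polynomial [Finite k] {L : Type*} [Field L] [Algebra k L] (a b : Polynomial L) :
    (a + b) ^ Nat.card k = a ^ Nat.card k + b ^ Nat.card k := by
  have := Fintype.ofFinite k
  obtain ⟨p, hp⟩ := CharP.exists k
  obtain ⟨n, hpr, hn⟩ := FiniteField.card k p
  have : Fact p.Prime := ⟨hpr⟩
  have : CharP L p := charP_of_injective_algebraMap (algebraMap k L).injective p
  have : ExpChar (Polynomial L) p := ExpChar.prime hpr
  rw [Nat.card_eq_fintype_card, hn]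
  exact add_pow_expChar_pow a b p n

lemma algebraMap_pow_natCard [Finite k] {L : Type*} [Field L] [Algebra k L] (v : Fin 3 → k) (i : Fin 3) :
    (algebraMap k L ∘ v) i ^ Nat.card k = (algebraMap k L ∘ v) i := by
  have := Fintype.ofFinite k
  rw [Nat.card_eq_fintype_card, Function.comp_apply, ← map_pow, FiniteField.pow_card]

/-- The curve and its Frobenius form have contact of order `r` with a common line at `v`. -/
def HasCommonContact (F : MvPolynomial (Fin 3) K) (q : ℕ) (v : Fin 3 → K) (r : ℕ) : Prop :=
  ∃ w, LinearIndependent K ![v, w] ∧ Polynomial.X ^ r ∣ restrictHom v w F ∧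
    Polynomial.X ^ r ∣ restrictHom v w (frobeniusForm q F)

/-- Bézout is applied over the closure, where `F` is still prime. Classicality is assumed over `k`;
it passes to the closure because divisibility descends. -/
lemma sum_hasCommonContact_le {m : ℕ} {F : MvPolynomial (Fin 3) k} (hF : F.IsHomogeneous m)
    (hcl : IsFrobeniusClassical F) {ι : Type*} [Fintype ι]
    (v : ι → Fin 3 → AlgebraicClosure k)
    (hvv : ∀ i j, i ≠ j → LinearIndependent (AlgebraicClosure k) ![v i, v j]) (r : ι → ℕ)
    (h : ∀ i, HasCommonContact (map (algebraMap k (AlgebraicClosure k)) F) (Nat.card k) (v i) (r i)) :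
    ∑ i, r i ≤ m * (Nat.card k + (m - 1)) := by
  choose w hw hF' hG' using h
  refine sum_contact_le_mul (hF.map _) (isHomogeneous_frobeniusForm (hF.map _) _)
    hcl.1.prime ?_ v w hw hvv r hF' hG'
  rw [← map_frobeniusForm]
  exact fun h => hcl.2 (dvd_of_map_dvd_map h)

lemma linearIndependent_algebraMap_pair {L : Type*} [Field L] [Algebra K L] {v w : Fin 3 → K}
    (h : LinearIndependent K ![v, w]) :
    LinearIndependent L ![algebraMap K L ∘ v, algebraMap K L ∘ w] := by
  have h' := (linearIndependent_algebraMap_comp_iff (S := L)).2 h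
  have h2 : ![algebraMap K L ∘ v, algebraMap K L ∘ w] = fun i => algebraMap K L ∘ ![v, w] i := by
    ext i
    fin_cases i <;> rfl
  rw [h2]
  exact h'

lemma linearIndependent_rep_pair (L : Type*) [Field L] [Algebra K L] {P Q : ℙ K (Fin 3 → K)}
    (h : P ≠ Q) : LinearIndependent L ![algebraMap K L ∘ P.rep, algebraMap K L ∘ Q.rep] :=
  linearIndependent_algebraMap_pair (Projectivization.linearIndependent_pair_iff_ne.2 h)

/-- The direction is chosen over `k` before extending scalars, so it is fixed by Frobenius. -/
lemma hasCommonContact_of_le_tangentMultiplicity [Finite k] {L : Type*} [Field L] [Algebra k L] {m : ℕ}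
    {F : MvPolynomial (Fin 3) k} (hF : F.IsHomogeneous m) {P : ℙ k (Fin 3 → k)} {r : ℕ}
    (hr : (r : ℕ∞) ≤ tangentMultiplicity F P) :
    HasCommonContact (map (algebraMap k L) F) (Nat.card k) (algebraMap k L ∘ P.rep) r := by
  obtain ⟨w, hw, hw'⟩ := exists_contact_of_le_tangentMultiplicity hr
  have h1 : Polynomial.X ^ r ∣ restrictHom (algebraMap k L ∘ P.rep) (algebraMap k L ∘ w)
      (map (algebraMap k L) F) := by
    rw [restrictHom_map]
    simpa using Polynomial.map_dvd (algebraMap k L) hw'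
  exact ⟨_, linearIndependent_algebraMap_pair hw, h1,
    X_pow_dvd_frobeniusForm_of_rational Nat.card_pos.ne' (hF.map _) add_pow_natCard_polynomial
      (algebraMap_pow_natCard _) (algebraMap_pow_natCard _) h1⟩

lemma algebraMap_comp_rep_ne_zero (L : Type*) [Field L] [Algebra K L] (P : ℙ K (Fin 3 → K)) :
    algebraMap K L ∘ P.rep ≠ 0 := by
  intro h
  apply P.rep_nonzero
  ext i
  simpa using congrFun h i

lemma eval_map_algebraMap {L : Type*} [Field L] [Algebra K L] (v : Fin 3 → K)
    (F : MvPolynomial (Fin 3) K) :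
    eval (algebraMap K L ∘ v) (map (algebraMap K L) F) = algebraMap K L (eval v F) := by
  rw [eval_map, eval₂_comp]

lemma hasCommonContact_three_of_singular [Finite k] {L : Type*} [Field L] [Algebra k L] [IsAlgClosed L] {m : ℕ}
    {F : MvPolynomial (Fin 3) k} (hF : F.IsHomogeneous m) {P : ℙ k (Fin 3 → k)}
    (hP : IsSingularPoint F P) :
    HasCommonContact (map (algebraMap k L) F) (Nat.card k) (algebraMap k L ∘ P.rep) 3 := by
  refine exists_contact_three_of_singular (Finite.one_lt_card) (hF.map _)
    add_pow_natCard_polynomial (algebraMap_comp_rep_ne_zero L P) (algebraMap_pow_natCard _) ?_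
    fun i => ?_
  · rw [eval_map_algebraMap, show eval P.rep F = 0 from hP.1, map_zero]
  · rw [pderiv_map, eval_map_algebraMap, hP.2, map_zero]

/-- The Frobenius form lies in the ideal of the partials, so it vanishes at every singular point,
rational or not. -/
lemma hasCommonContact_one_of_singular {q : ℕ} {F : MvPolynomial (Fin 3) K} {P : ℙ K (Fin 3 → K)}
    (hP : IsSingularPoint F P) : HasCommonContact F q P.rep 1 := by
  obtain ⟨w, hw⟩ := exists_linearIndependent_pair_of_one_lt_finrank (R := K)
    (M := Fin 3 → K) (by simp) P.rep_nonzero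
  refine ⟨w, hw, ?_, ?_⟩
  · rw [pow_one, Polynomial.X_dvd_iff, coeff_zero_restrictHom]
    exact hP.1
  · rw [pow_one, Polynomial.X_dvd_iff, coeff_zero_restrictHom, frobeniusForm, map_sum]
    exact Finset.sum_eq_zero fun i _ => by rw [map_mul, hP.2, mul_zero]

/-- Infinite multiplicity would give contact of every order, and one more than the Bézout number at
a single point is already absurd. -/
lemma tangentMultiplicity_ne_top [Finite k] {m : ℕ} {F : MvPolynomial (Fin 3) k} (hF : F.IsHomogeneous m)
    (hcl : IsFrobeniusClassical F) (P : ℙ k (Fin 3 → k)) : tangentMultiplicity F P ≠ ⊤ := by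
  intro h
  have := sum_hasCommonContact_le hF hcl (ι := Unit) (fun _ => algebraMap k _ ∘ P.rep)
    (fun i j hij => absurd (Subsingleton.elim i j) hij)
    (fun _ => m * (Nat.card k + (m - 1)) + 1)
    fun _ => hasCommonContact_of_le_tangentMultiplicity hF (h ▸ le_top)
  simp at this

/-- The guaranteed order of contact of the curve with its Frobenius form at a rational point. -/
def contactOrder (F : MvPolynomial (Fin 3) K) (P : ℙ K (Fin 3 → K)) : ℕ :=
  open Classical in if IsSingularPoint F P then 3 else (tangentMultiplicity F P).toNat

lemma hasCommonContact_contactOrder [Finite k] {L : Type*} [Field L] [Algebra k L] [IsAlgClosed L] {m : ℕ}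
    {F : MvPolynomial (Fin 3) k} (hF : F.IsHomogeneous m) (P : ℙ k (Fin 3 → k)) :
    HasCommonContact (map (algebraMap k L) F) (Nat.card k) (algebraMap k L ∘ P.rep)
      (contactOrder F P) := by
  unfold contactOrder
  split_ifs with hs
  · exact hasCommonContact_three_of_singular hF hs
  · exact hasCommonContact_of_le_tangentMultiplicity hF (ENat.natCast_toNat_le_self _)

/-- The sum of the contact orders counts every point twice, every inflection point with its excess,
and the singular points once more. -/
lemma two_mul_ncard_add_finsum [Finite k] {m : ℕ} {F : MvPolynomial (Fin 3) k} (hF : F.IsHomogeneous m)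
    (hcl : IsFrobeniusClassical F) [Fintype (points F)] :
    2 * ((points F).ncard : ℝ) + ∑ᶠ P ∈ inflectionPoints F,
      (((tangentMultiplicity F P).toNat : ℝ) - 2) + ((points F ∩ {P | IsSingularPoint F P}).ncard : ℝ) =
      ((∑ P : points F, contactOrder F P : ℕ) : ℝ) := by
  classical
  have hfin : (points F).toFinset.card = (points F).ncard := (Set.ncard_eq_toFinset_card' _).symm
  have h1 : ∑ᶠ P ∈ inflectionPoints F, (((tangentMultiplicity F P).toNat : ℝ) - 2) =
      ∑ P ∈ (points F).toFinset, if P ∈ inflectionPoints F then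
        (((tangentMultiplicity F P).toNat : ℝ) - 2) else 0 := by
    rw [← Finset.sum_filter, ← finsum_mem_coe_finset]
    congr! 3 with P
    simp only [Finset.coe_filter, Set.mem_toFinset, Set.mem_ofPred_eq]
    exact ⟨fun h => ⟨h.1, h⟩, fun h => h.2⟩
  have h2 : ((points F ∩ {P | IsSingularPoint F P}).ncard : ℝ) =
      ∑ P ∈ (points F).toFinset, if IsSingularPoint F P then (1 : ℝ) else 0 := by
    rw [Finset.sum_boole, ← Set.ncard_coe_finset]
    congr 2
    ext P
    simp
  have h3 : ((∑ P : points F, contactOrder F P : ℕ) : ℝ) =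
      ∑ P ∈ (points F).toFinset, (contactOrder F P : ℝ) := by
    rw [Nat.cast_sum]
    exact (Finset.sum_subtype (points F).toFinset (fun P => by simp)
      (fun P => (contactOrder F P : ℝ))).symm
  rw [h1, h2, h3, ← hfin, Finset.card_eq_sum_ones, Nat.cast_sum, Finset.mul_sum,
    ← Finset.sum_add_distrib, ← Finset.sum_add_distrib]
  refine Finset.sum_congr rfl fun P hP => ?_
  have hP : P ∈ points F := by simpa using hP
  by_cases hs : IsSingularPoint F P
  · rw [if_neg (fun h => h.2.1 hs), if_pos hs, contactOrder, if_pos hs]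
    norm_num
  · rw [if_neg hs, contactOrder, if_neg hs]
    split_ifs with hi
    · norm_num
    · have h4 := two_le_tangentMultiplicity hP
      have h5 : ¬ 3 ≤ tangentMultiplicity F P := fun h => hi ⟨hP, hs, h⟩
      obtain ⟨t, ht⟩ := ENat.ne_top_iff_exists.1 (tangentMultiplicity_ne_top hF hcl P)
      rw [← ht] at h4 h5 ⊢
      have h4 : 2 ≤ t := by exact_mod_cast h4
      have h5 : ¬ 3 ≤ t := by exact_mod_cast h5
      have : t = 2 := by omega
      simp [this]

/-- A singular point over the algebraic closure forces an excess of contact. -/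
lemma sum_contactOrder_lt_of_singular [Finite k] {m : ℕ} {F : MvPolynomial (Fin 3) k} (hF : F.IsHomogeneous m)
    (hcl : IsFrobeniusClassical F) [Fintype (points F)]
    (hns : ∀ P, ¬ IsSingularPoint F P)
    {Q : ℙ (AlgebraicClosure k) (Fin 3 → AlgebraicClosure k)}
    (hQ : IsSingularPoint (map (algebraMap k (AlgebraicClosure k)) F) Q) :
    ∑ P : points F, contactOrder F P < m * (Nat.card k + (m - 1)) := by
  -- If `Q` were proportional to a rational point, the partials would vanish there by homogeneity,
  -- making that point singular.
  have hind : ∀ P : points F, LinearIndependent (AlgebraicClosure k)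
      ![Q.rep, algebraMap k (AlgebraicClosure k) ∘ P.1.rep] := by
    intro P
    refine (LinearIndependent.pair_iff' Q.rep_nonzero).2 fun c hc => hns P.1 ⟨P.2, fun i => ?_⟩
    have h := eval_smul_of_isHomogeneous ((hF.map (algebraMap k (AlgebraicClosure k))).pderiv (i := i)) c Q.rep
    rw [hc, hQ.2, mul_zero, pderiv_map, eval_map_algebraMap] at h
    simpa using h
  -- The index `none` stands for `Q`, with contact 1.
  have := sum_hasCommonContact_le hF hcl (ι := Option (points F))
    (fun o => o.elim Q.rep fun P => algebraMap k _ ∘ P.1.rep) ?_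
    (fun o => o.elim 1 fun P => contactOrder F P.1) ?_
  · rw [Fintype.sum_option] at this
    simp only [Option.elim] at this
    omega
  · rintro (_ | P) (_ | P') h
    · exact absurd rfl h
    · exact hind P'
    · exact LinearIndependent.pair_symm_iff.1 (hind P)
    · exact linearIndependent_rep_pair _ fun h' => h (congrArg some (Subtype.ext h'))
  · rintro (_ | P)
    · exact hasCommonContact_one_of_singular hQ
    · exact hasCommonContact_contactOrder hF P.1

end FiniteField

end PlaneCurve

end

theorem theorem5 {k : Type*} [Field k] [Finite k] (m : ℕ) (F : MvPolynomial (Fin 3) k)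
    (hF : F.IsHomogeneous m) (hcl : PlaneCurve.IsFrobeniusClassical F) :
    (∀ P ∈ PlaneCurve.inflectionPoints F, PlaneCurve.tangentMultiplicity F P ≠ ⊤) ∧
    ((PlaneCurve.points F).ncard : ℝ) ≤
      ((m : ℝ) * ((m : ℝ) + (Nat.card k : ℝ) - 1) -
        ∑ᶠ P ∈ PlaneCurve.inflectionPoints F,
          (((PlaneCurve.tangentMultiplicity F P).toNat : ℝ) - 2)) / 2 ∧
    (((PlaneCurve.points F).ncard : ℝ) =
      ((m : ℝ) * ((m : ℝ) + (Nat.card k : ℝ) - 1) -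
        ∑ᶠ P ∈ PlaneCurve.inflectionPoints F,
          (((PlaneCurve.tangentMultiplicity F P).toNat : ℝ) - 2)) / 2 →
      PlaneCurve.IsNonsingular F) := by
  have := Fintype.ofFinite (PlaneCurve.points F)
  have hsum := PlaneCurve.two_mul_ncard_add_finsum hF hcl
  have hle : ∑ P : PlaneCurve.points F, PlaneCurve.contactOrder F P ≤
      m * (Nat.card k + (m - 1)) :=
    PlaneCurve.sum_hasCommonContact_le hF hcl (fun P : PlaneCurve.points F => algebraMap k _ ∘ P.1.rep)
      (fun P P' h => PlaneCurve.linearIndependent_rep_pair _ fun h' => h (Subtype.ext h')) _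
      fun P => PlaneCurve.hasCommonContact_contactOrder hF P.1
  have hcast : ((m * (Nat.card k + (m - 1)) : ℕ) : ℝ) = m * (m + Nat.card k - 1) := by
    -- The truncated `m - 1` is wrong only for `m = 0`, where both sides vanish.
    rcases m with _ | m
    · simp
    · push_cast [Nat.add_sub_cancel]
      ring
  have hle' := (Nat.cast_le (α := ℝ)).2 hle
  have hpos := Nat.cast_nonneg (α := ℝ)
    (PlaneCurve.points F ∩ {P | PlaneCurve.IsSingularPoint F P}).ncard
  refine ⟨fun P _ => PlaneCurve.tangentMultiplicity_ne_top hF hcl P, by linarith, fun heq Q hQ => ?_⟩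
  -- Equality makes the first two terms of `hsum` exhaust the Bézout bound, leaving no room for
  -- singular rational points.
  have h0 : ((PlaneCurve.points F ∩ {P | PlaneCurve.IsSingularPoint F P}).ncard : ℝ) = 0 := by
    linarith
  have hns : ∀ P, ¬ PlaneCurve.IsSingularPoint F P := by
    intro P hP
    rw [Nat.cast_eq_zero, Set.ncard_eq_zero (Set.toFinite _)] at h0
    exact Set.notMem_empty P (h0 ▸ ⟨hP.1, hP⟩)
  have hlt := (Nat.cast_lt (α := ℝ)).2 (PlaneCurve.sum_contactOrder_lt_of_singular hF hcl hns hQ)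
  linarith
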